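/- A tile (type) over a glue alphabet $\Sigma$ is a $4$-tuple of glues (north, east, south, west side). A hierarchical tile assembly system is a triple $\mathcal{T}=(T,\tau,\mathrm{str})$ with $T$ a finite set of tile types, $\tau\in\mathbb{N}$ the temperature, and $\mathrm{str}:\Sigma\times\Sigma\to\mathbb{N}$ the interaction strength. An assembly is a partial map $\alpha:\mathbb{Z}^2\dashrightarrow T$ whose domain induces a connected subgraph of the square lattice. A lattice edge between two points of $\operatorname{dom}\alpha$ has weight equal to the interaction strength of the two glues on the abutting sides of the tiles at its end-points (if $\mathrm{str}$ is not symmetric, the glues are taken in the order west to east, respectively south to north). An assembly is producible in $\mathcal{T}$ if its domain is a single point, or if it is the union of two producible assemblies with disjoint domains such that the edges between the two domains have total weight at least $\tau$ (the producible assemblies are the smallest class with this property; in particular they are finite). For $\vec v\in\mathbb{Z}^2$ let $\alpha+\vec v$ be the assembly with domain $\operatorname{dom}\alpha+\vec v$ and $(\alpha+\vec v)(p)=\alpha(p-\vec v)$. An assembly $\alpha$ is repetitious if there is a nonzero $\vec v\in\mathbb{Z}^2$ such that $\operatorname{dom}\alpha\cap\operatorname{dom}(\alpha+\vec v)\neq\emptyset$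 and $\alpha(p)=(\alpha+\vec v)(p)$ for all $p$ in this intersection. Theorem. Let $\mathcal{T}$ be a hierarchical tile assembly system. If some assembly producible in $\mathcal{T}$ is repetitious, then arbitrarily large assemblies are producible in $\mathcal{T}$: for every $n\in\mathbb{N}$ there is an assembly $\gamma$ producible in $\mathcal{T}$ with $|\operatorname{dom}\gamma|>n$. -/

import Mathlib

namespace TileAssembly

/-- The square lattice: vertex set `ℤ × ℤ`, edges between points at distance one. -/
def lattice : SimpleGraph (ℤ × ℤ) where
  Adj p q := |p.1 - q.1| + |p.2 - q.2| = 1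
  symm := ⟨fun p q h => by rw [abs_sub_comm q.1, abs_sub_comm q.2]; exact h⟩
  loopless := ⟨fun p h => by simp at h⟩

/-- A tile (type) over the glue alphabet `G`: the glues on its four sides. -/
@[ext]
structure Tile (G : Type*) where
  north : G
  east : G
  south : G
  west : G

/-- A hierarchical tile assembly system: a finite set of tile types, a temperature and an
interaction strength for pairs of glues. -/
structure HierarchicalTAS (G : Type*) where
  tiles : Finset (Tile G)
  temperature : ℕ
  str : G → G → ℕ

/-- An assembly on the set `T` of tiles: a partial map from `ℤ × ℤ` to `T` whose domain induces a
connected subgraph of the lattice. -/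
@[ext]
structure Assembly {G : Type*} (T : Finset (Tile G)) where
  tile : ℤ × ℤ → Option T
  connected : (lattice.induce {p | (tile p).isSome}).Connected

namespace Assembly

variable {G : Type*} {T : Finset (Tile G)}

/-- The domain of an assembly. -/
def dom (α : Assembly T) : Set (ℤ × ℤ) := {p | (α.tile p).isSome}

/-- Two assemblies do not overlap. -/
def Nonoverlapping (α β : Assembly T) : Prop := α.dom ∩ β.dom = ∅

/-- Two assemblies are consistent if they agree wherever both are defined. -/
def Consistent (α β : Assembly T) : Prop := ∀ p ∈ α.dom ∩ β.dom, α.tile p = β.tile p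

/-- `γ` is the union of the (consistent) assemblies `α` and `β`. -/
def IsUnion (γ α β : Assembly T) : Prop :=
  γ.dom = α.dom ∪ β.dom ∧ (∀ p ∈ α.dom, γ.tile p = α.tile p) ∧ ∀ p ∈ β.dom, γ.tile p = β.tile p

/-- An assembly is singular if it consists of one tile. -/
def Singular (γ : Assembly T) : Prop := γ.dom.ncard = 1

/-- The translation `α + v`, with `(α + v)(p) = α(p - v)`. -/
def translate (α : Assembly T) (v : ℤ × ℤ) : Assembly T where
  tile p := α.tile (p - v)
  connected := by
    let e : lattice.induce {p | (α.tile p).isSome} ≃g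
        lattice.induce {p | (α.tile (p - v)).isSome} :=
      { toEquiv := (Equiv.addRight v).subtypeEquiv (fun p => by simp)
        map_rel_iff' := by
          intro a b
          simp [lattice, Equiv.subtypeEquiv] }
    exact e.connected_iff.mp α.connected

/-- An assembly is repetitious if it overlaps, and is consistent with, its translation by some
nonzero integer vector. -/
def Repetitious (α : Assembly T) : Prop :=
  ∃ v : ℤ × ℤ, v ≠ 0 ∧ (α.dom ∩ (α.translate v).dom).Nonempty ∧ α.Consistent (α.translate v)

/-- The weight of the lattice edge `pq` in the assembly `γ`: the interaction strength of the glues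
on the abutting sides of the tiles at `p` and `q` (and `0` if `pq` is not an edge of the graph of
`γ`). The edge is read from west to east or from south to north, so the weight does not depend on
the order of `p` and `q`, and `str` need not be assumed symmetric; if `str` is symmetric, the
reading direction is immaterial. -/
def edgeWeight (str : G → G → ℕ) (γ : Assembly T) (p q : ℤ × ℤ) : ℕ :=
  match γ.tile p, γ.tile q with
  | some s, some t =>
    if q = p + (1, 0) then str s.1.east t.1.west
    else if q = p + (0, 1) then str s.1.north t.1.south
    else if p = q + (1, 0) then str t.1.east s.1.west
    else if p = q + (0, 1) then str t.1.north s.1.south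
    else 0
  | _, _ => 0

/-- The edges of the lattice with one end-point in `dom α` and the other one in `dom β`, each
written as a pair whose first entry is the end-point in `dom α`. -/
def cut (α β : Assembly T) : Set ((ℤ × ℤ) × (ℤ × ℤ)) :=
  {e | e.1 ∈ α.dom ∧ e.2 ∈ β.dom ∧ lattice.Adj e.1 e.2}

/-- A set `C` of edges of `γ` is `τ`-stable if the sum of its weights is at least `τ`. The weights
are natural numbers, so this means that finitely many edges of `C` have total weight at least `τ`
(if `C` is finite, one may take all of `C`). -/
def StableEdges (str : G → G → ℕ) (τ : ℕ) (γ : Assembly T) (C : Set ((ℤ × ℤ) × (ℤ × ℤ))) : Prop :=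
  ∃ F : Finset ((ℤ × ℤ) × (ℤ × ℤ)), (F : Set ((ℤ × ℤ) × (ℤ × ℤ))) ⊆ C ∧
    τ ≤ ∑ e ∈ F, γ.edgeWeight str e.1 e.2

end Assembly

/-- The producible assemblies of a hierarchical tile assembly system: the single tiles, and the
unions of two nonoverlapping producible assemblies whose cut is stable at the temperature of the
system. -/
inductive HierarchicalTAS.Producible {G : Type*} (𝒯 : HierarchicalTAS G) :
    Assembly 𝒯.tiles → Prop
  | singular (γ : Assembly 𝒯.tiles) (h : γ.Singular) : 𝒯.Producible γ
  | union (α β γ : Assembly 𝒯.tiles) (hα : 𝒯.Producible α) (hβ : 𝒯.Producible β)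
      (hd : α.Nonoverlapping β) (hγ : γ.IsUnion α β)
      (hs : γ.StableEdges 𝒯.str 𝒯.temperature (α.cut β)) : 𝒯.Producible γ

end TileAssembly

/-!
Let `α` be a producible assembly that is consistent with, and overlaps, its translation by `v ≠ 0`.
Some connected component `C` of `(α + v) \ α` is such that `C + v` misses `α`. Replaying the
production of `α + v` on top of `α`, but keeping only the tiles in `C`, shows that the union of `α`
and `(α + v)|C` is producible. It is larger than `α`, and it is again consistent with its
translation by `v`, so the extension can be repeated forever.

If there were no such `C`, consider the points of `(α + v) \ α` that are outermost on their lines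
parallel to `v`. From each of them one could walk through its component to a point `h` with
`h + v ∈ α`, leaving the outermost points at some moment; jumping from there to the outermost point
of the same line is a translation by at least `2v`. Walking and jumping in this way one eventually
runs in a cycle. Undoing the jumps turns the cycle into a lattice path that is periodic up to a
multiple of `v`; by a winding number argument, such a path has a chord equal to `v`. The jumps made
along that chord add up to exactly `v`, which is impossible.
-/

namespace TileAssembly

section Crossing

variable {R : Type*} [CommRing R]

/-- The determinant of two vectors of the plane. -/
def wedge (p q : R × R) : R := p.1 * q.2 - p.2 * q.1

/-- The standard inner product of the plane. -/
def dot (p q : R × R) : R := p.1 * q.1 + p.2 * q.2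

theorem wedge_smul_self (v : R × R) (c : R) : wedge v (c • v) = 0 := by
  simp only [wedge, Prod.smul_fst, Prod.smul_snd, smul_eq_mul]
  ring

theorem dot_comm (p q : R × R) : dot p q = dot q p := by
  simp only [dot, mul_comm]

theorem dot_add_left (p q r : R × R) : dot (p + q) r = dot p r + dot q r := by
  simp only [dot, Prod.fst_add, Prod.snd_add]
  ring

theorem dot_smul (c : R) (v p : R × R) : dot v (c • p) = c * dot v p := by
  simp only [dot, Prod.smul_fst, Prod.smul_snd, smul_eq_mul]
  ring

theorem dot_mul_wedge_sub_dot_mul_wedge (u v p q : R × R) :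
    dot u p * wedge v q - dot u q * wedge v p = dot u v * wedge p q := by
  simp only [dot, wedge]
  ring

theorem dot_mul_dot_add_wedge_mul_wedge (v p q : R × R) :
    dot v p * dot v q + wedge v p * wedge v q = dot v v * dot p q := by
  simp only [dot, wedge]
  ring

variable [LinearOrder R]

/-- The signed number of times the segment from `p` to `q` crosses the open ray from the origin
through `v`, counterclockwise crossings being positive. A point on the ray counts as lying on the
clockwise side of it. -/
def crossing (v p q : R × R) : ℤ :=
  (if wedge v p ≤ 0 ∧ 0 < wedge v q ∧ 0 < wedge p q then 1 else 0) -
    (if wedge v q ≤ 0 ∧ 0 < wedge v p ∧ 0 < wedge q p then 1 else 0)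

theorem crossing_of_wedge_nonpos {v p q : R × R} (hp : wedge v p ≤ 0) (hq : wedge v q ≤ 0) :
    crossing v p q = 0 := by
  simp only [crossing, hp.not_gt, hq.not_gt, false_and, and_false, if_false, sub_zero]

variable [IsStrictOrderedRing R]

theorem dot_self_pos {v : R × R} (hv : v ≠ 0) : 0 < dot v v := by
  have : v.1 ≠ 0 ∨ v.2 ≠ 0 := by
    by_contra! h
    exact hv (Prod.ext h.1 h.2)
  rcases this with h | h <;> simp only [dot] <;>
    nlinarith [mul_self_pos.mpr h, mul_self_nonneg v.1, mul_self_nonneg v.2]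

theorem crossing_of_dot_pos {u v p q : R × R} (hp : 0 < dot u p) (hq : 0 < dot u q) :
    crossing v p q = if 0 < dot u v then
      (if 0 < wedge v q then 1 else 0) - (if 0 < wedge v p then 1 else 0) else 0 := by
  have upward : wedge v p ≤ 0 → 0 < wedge v q → (0 < wedge p q ↔ 0 < dot u v) := by
    intro h h'
    have hpos : 0 < dot u v * wedge p q := by
      nlinarith [dot_mul_wedge_sub_dot_mul_wedge u v p q]
    exact (pos_iff_pos_of_mul_pos hpos).symm
  have downward : wedge v q ≤ 0 → 0 < wedge v p → (0 < wedge q p ↔ 0 < dot u v) := by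
    intro h h'
    have hpos : 0 < dot u v * wedge q p := by
      nlinarith [dot_mul_wedge_sub_dot_mul_wedge u v q p]
    exact (pos_iff_pos_of_mul_pos hpos).symm
  unfold crossing
  grind

theorem crossing_of_wedge_nonneg {v p q : R × R} (hv : v ≠ 0) (hp : 0 ≤ wedge v p)
    (hq : 0 ≤ wedge v q) (hpq : 0 < dot p q) :
    crossing v p q = (if wedge v p = 0 ∧ 0 < dot v p then 1 else 0) -
      (if wedge v q = 0 ∧ 0 < dot v q then 1 else 0) := by
  have hvv := dot_self_pos hv
  rcases hp.eq_or_lt' with hp | hp <;> rcases hq.eq_or_lt' with hq | hq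
  · have hdot : 0 < dot v p * dot v q := by
      have := dot_mul_dot_add_wedge_mul_wedge v p q
      rw [hp, zero_mul, add_zero] at this
      exact this ▸ mul_pos hvv hpq
    simp only [crossing, hp, hq, lt_irrefl, false_and, and_false, true_and, if_false,
      pos_iff_pos_of_mul_pos hdot, sub_self]
  · have : 0 < wedge p q ↔ 0 < dot v p := by
      have key := dot_mul_wedge_sub_dot_mul_wedge v v p q
      rw [hp, mul_zero, sub_zero] at key
      rw [← mul_pos_iff_of_pos_left hvv, ← key, mul_pos_iff_of_pos_right hq]
    simp [crossing, hp, hq, hq.ne', this]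
  · have : 0 < wedge q p ↔ 0 < dot v q := by
      have key := dot_mul_wedge_sub_dot_mul_wedge v v q p
      rw [hq, mul_zero, sub_zero] at key
      rw [← mul_pos_iff_of_pos_left hvv, ← key, mul_pos_iff_of_pos_right hp]
    simp [crossing, hp, hq, hp.ne', this]
  · simp [crossing, hp.not_ge, hq.not_ge, hp.ne', hq.ne']

end Crossing

section CrossingSum

variable {R : Type*} [CommRing R] [LinearOrder R]

/-- The signed number of times the first `n` steps of the path `z` cross the open ray from the
origin through `v`; it serves as a winding number of `z` about the origin. -/
def crossingSum (v : R × R) (z : ℕ → R × R) (n : ℕ) : ℤ :=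
  ∑ k ∈ Finset.range n, crossing v (z k) (z (k + 1))

theorem crossingSum_succ_of_homotopy {v : R × R} {a b : ℕ → R × R} (h0 : a 0 = b 0)
    (hsq : ∀ k, crossing v (b k) (a (k + 1)) + crossing v (a (k + 1)) (a (k + 2)) =
      crossing v (b k) (b (k + 1)) + crossing v (b (k + 1)) (a (k + 2))) (n : ℕ) :
    crossingSum v a (n + 1) = crossingSum v b n + crossing v (b n) (a (n + 1)) := by
  induction n with
  | zero => simp [crossingSum, h0]
  | succ n ih =>
    have ha : crossingSum v a (n + 2) = crossingSum v a (n + 1) +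
        crossing v (a (n + 1)) (a (n + 2)) := Finset.sum_range_succ _ _
    have hb : crossingSum v b (n + 1) = crossingSum v b n +
        crossing v (b n) (b (n + 1)) := Finset.sum_range_succ _ _
    linarith [hsq n]

theorem crossingSum_of_wedge_nonpos {v : R × R} {z : ℕ → R × R} (hz : ∀ k, wedge v (z k) ≤ 0)
    (n : ℕ) : crossingSum v z n = 0 :=
  Finset.sum_eq_zero fun _ _ => crossing_of_wedge_nonpos (hz _) (hz _)

theorem crossingSum_of_wedge_nonneg [IsStrictOrderedRing R] {v : R × R} (hv : v ≠ 0)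
    {z : ℕ → R × R} (hz : ∀ k, 0 ≤ wedge v (z k)) (hdot : ∀ k, 0 < dot (z k) (z (k + 1))) (n : ℕ) :
    crossingSum v z n = (if wedge v (z 0) = 0 ∧ 0 < dot v (z 0) then 1 else 0) -
      (if wedge v (z n) = 0 ∧ 0 < dot v (z n) then 1 else 0) := by
  rw [crossingSum, Finset.sum_congr rfl fun k _ =>
    crossing_of_wedge_nonneg hv (hz k) (hz (k + 1)) (hdot k)]
  exact Finset.sum_range_sub'
    (fun k => if wedge v (z k) = 0 ∧ 0 < dot v (z k) then (1 : ℤ) else 0) n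

end CrossingSum

section Dynamics

theorem exists_forall_le_of_periodic {β : Type*} [LinearOrder β] {f : ℕ → β} {L : ℕ}
    (hf : Function.Periodic f L) (hL : L ≠ 0) : ∃ t, ∀ j, f j ≤ f t := by
  obtain ⟨t, -, ht⟩ := Finset.exists_max_image (Finset.range L) f (Finset.nonempty_range_iff.mpr hL)
  exact ⟨t, fun j => hf.map_mod_nat j ▸
    ht (j % L) (Finset.mem_range.mpr (Nat.mod_lt j (Nat.pos_of_ne_zero hL)))⟩

theorem exists_isPeriodicPt_of_finite {α : Type*} [Finite α] [Nonempty α] (f : α → α) :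
    ∃ x, ∃ n ≠ 0, Function.IsPeriodicPt f n x := by
  obtain ⟨x⟩ := ‹Nonempty α›
  obtain ⟨m, n, hmn, heq⟩ := Finite.exists_ne_map_eq_of_infinite fun n : ℕ => f^[n] x
  wlog hlt : m < n generalizing m n
  · exact this n m hmn.symm heq.symm (by lia)
  refine ⟨f^[m] x, n - m, by lia, ?_⟩
  rw [Function.IsPeriodicPt, Function.IsFixedPt, ← Function.iterate_add_apply,
    Nat.sub_add_cancel hlt.le]
  exact heq.symm

theorem birkhoffSum_ne_one {α : Type*} {f : α → α} {c : α → ℕ} (hc : ∀ x, c x ≠ 1) (n : ℕ)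
    (x : α) : birkhoffSum f c n x ≠ 1 := by
  induction n with
  | zero => simp
  | succ n ih =>
    rw [birkhoffSum_succ]
    have := hc (f^[n] x)
    lia

theorem birkhoffSum_ne_zero_of_isPeriodicPt {α : Type*} {f : α → α} {c rank : α → ℕ}
    (hrank : ∀ x, c x = 0 → rank (f x) < rank x) {n : ℕ} (hn : n ≠ 0) {x : α}
    (hx : Function.IsPeriodicPt f n x) : birkhoffSum f c n x ≠ 0 := by
  intro hsum
  have hzero : ∀ k < n, c (f^[k] x) = 0 := fun k hk =>
    Finset.sum_eq_zero_iff.mp hsum k (Finset.mem_range.mpr hk)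
  have hdecrease : ∀ k ≤ n, rank (f^[k] x) + k ≤ rank x := fun k => by
    induction k with
    | zero => simp
    | succ k ih =>
      intro hk
      have := hrank _ (hzero k hk)
      rw [Function.iterate_succ_apply']
      have := ih (by lia)
      lia
  have := hdecrease n le_rfl
  rw [hx.eq] at this
  lia

end Dynamics

section Lattice

theorem lattice_adj_iff {p q : ℤ × ℤ} : lattice.Adj p q ↔
    (q.1 = p.1 + 1 ∧ q.2 = p.2) ∨ (q.1 = p.1 - 1 ∧ q.2 = p.2) ∨
    (q.1 = p.1 ∧ q.2 = p.2 + 1) ∨ (q.1 = p.1 ∧ q.2 = p.2 - 1) := by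
  change |p.1 - q.1| + |p.2 - q.2| = 1 ↔ _
  grind

theorem lattice_adj_add_right {p q r : ℤ × ℤ} : lattice.Adj (p + r) (q + r) ↔ lattice.Adj p q := by
  simp [lattice]

theorem lattice_adj_sub_right {p q r : ℤ × ℤ} : lattice.Adj (p - r) (q - r) ↔ lattice.Adj p q := by
  simp [lattice]

theorem lattice_adj_sub_left {p q r : ℤ × ℤ} : lattice.Adj (r - p) (r - q) ↔ lattice.Adj p q := by
  simp [lattice, abs_sub_comm]

theorem dot_pos_of_lattice_adj {p q : ℤ × ℤ} (hpq : lattice.Adj p q) (hp : p ≠ 0) (hq : q ≠ 0) :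
    0 < dot p q := by
  have hsq : dot p p + dot q q = 2 * dot p q + 1 := by
    rcases lattice_adj_iff.mp hpq with h | h | h | h <;> simp only [dot, h.1, h.2] <;> ring
  linarith [Int.add_one_le_of_lt (dot_self_pos hp), Int.add_one_le_of_lt (dot_self_pos hq)]

theorem crossing_square (v : ℤ × ℤ) {p q r s : ℤ × ℤ} (hp : p ≠ 0) (hq : q ≠ 0) (hr : r ≠ 0)
    (hs : s ≠ 0) (hpq : lattice.Adj p q) (hpr : lattice.Adj p r) (hqs : lattice.Adj q s)
    (hrs : lattice.Adj r s) (h : p + s = q + r) :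
    crossing v p q + crossing v q s = crossing v p r + crossing v r s := by
  have pq := dot_pos_of_lattice_adj hpq hp hq
  have pr := dot_pos_of_lattice_adj hpr hp hr
  have qs := dot_pos_of_lattice_adj hqs hq hs
  have rs := dot_pos_of_lattice_adj hrs hr hs
  -- The square lies in the open half-plane around its center, so it does not wind around `0`.
  have hup : 0 < dot (p + s) p := by rw [h, dot_add_left, dot_comm q, dot_comm r]; positivity
  have hus : 0 < dot (p + s) s := by rw [h, dot_add_left]; positivity
  have huq : 0 < dot (p + s) q := by rw [dot_add_left, dot_comm s]; positivity
  have hur : 0 < dot (p + s) r := by rw [dot_add_left, dot_comm s]; positivity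
  rw [crossing_of_dot_pos hup huq, crossing_of_dot_pos huq hus, crossing_of_dot_pos hup hur,
    crossing_of_dot_pos hur hus]
  split_ifs <;> rfl

/-- The `k`-th vector of the path that traces the failure of `w i` and `w (i + k)` to differ by
exactly `v`: it vanishes if and only if they do. -/
def chordDefect (v : ℤ × ℤ) (w : ℕ → ℤ × ℤ) (i k : ℕ) : ℤ × ℤ := w (i + k) - w i - v

theorem chordDefect_eq_zero_iff {v : ℤ × ℤ} {w : ℕ → ℤ × ℤ} {i k : ℕ} :
    chordDefect v w i k = 0 ↔ w (i + k) = w i + v := by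
  rw [chordDefect, sub_sub, sub_eq_zero]

theorem chordDefect_zero (v : ℤ × ℤ) (w : ℕ → ℤ × ℤ) (i : ℕ) : chordDefect v w i 0 = -v := by
  simp [chordDefect]

theorem wedge_chordDefect (v : ℤ × ℤ) (w : ℕ → ℤ × ℤ) (i k : ℕ) :
    wedge v (chordDefect v w i k) = wedge v (w (i + k)) - wedge v (w i) := by
  simp only [chordDefect, wedge, Prod.fst_sub, Prod.snd_sub]
  ring

theorem lattice_adj_chordDefect_succ_right (v : ℤ × ℤ) {w : ℕ → ℤ × ℤ}
    (hw : ∀ k, lattice.Adj (w k) (w (k + 1))) (i k : ℕ) :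
    lattice.Adj (chordDefect v w i k) (chordDefect v w i (k + 1)) := by
  simpa only [chordDefect, lattice_adj_sub_right, ← Nat.add_assoc] using hw (i + k)

theorem lattice_adj_chordDefect_succ_left (v : ℤ × ℤ) {w : ℕ → ℤ × ℤ}
    (hw : ∀ k, lattice.Adj (w k) (w (k + 1))) (i k : ℕ) :
    lattice.Adj (chordDefect v w (i + 1) k) (chordDefect v w i (k + 1)) := by
  rw [chordDefect, chordDefect, lattice_adj_sub_right, Nat.add_right_comm, ← Nat.add_assoc,
    lattice_adj_sub_left]
  exact (hw i).symm

theorem crossingSum_chordDefect_succ {v : ℤ × ℤ} {w : ℕ → ℤ × ℤ}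
    (hw : ∀ k, lattice.Adj (w k) (w (k + 1))) (hne : ∀ i k, chordDefect v w i k ≠ 0) {L : ℕ}
    {e : ℤ × ℤ} (hper : ∀ k, w (k + L) = w k + e) (hL : L ≠ 0) (i : ℕ) :
    crossingSum v (chordDefect v w i) L = crossingSum v (chordDefect v w (i + 1)) L := by
  obtain ⟨n, rfl⟩ := Nat.exists_eq_succ_of_ne_zero hL
  have hend : chordDefect v w i (n + 1) = chordDefect v w (i + 1) (n + 1) := by
    simp only [chordDefect, hper]
    abel
  rw [crossingSum_succ_of_homotopy (b := chordDefect v w (i + 1))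
    (by rw [chordDefect_zero, chordDefect_zero]), hend, crossingSum, crossingSum,
    Finset.sum_range_succ]
  intro k
  refine crossing_square v (hne _ _) (hne _ _) (hne _ _) (hne _ _)
    (lattice_adj_chordDefect_succ_left v hw i k) (lattice_adj_chordDefect_succ_right v hw _ k)
    (lattice_adj_chordDefect_succ_right v hw i _) (lattice_adj_chordDefect_succ_left v hw i _) ?_
  simp only [chordDefect, ← Nat.add_assoc, Nat.add_right_comm _ 1]
  abel

theorem crossingSum_chordDefect_of_wedge_ge {v : ℤ × ℤ} (hv : v ≠ 0) {w : ℕ → ℤ × ℤ}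
    (hw : ∀ k, lattice.Adj (w k) (w (k + 1))) (hne : ∀ i k, chordDefect v w i k ≠ 0) {L M : ℕ}
    (hM : M ≠ 0) (hper : ∀ k, w (k + L) = w k + M • v) {i : ℕ}
    (hi : ∀ j, wedge v (w i) ≤ wedge v (w j)) : crossingSum v (chordDefect v w i) L = -1 := by
  have hend : chordDefect v w i L = (M - 1 : ℤ) • v := by
    rw [chordDefect, hper, sub_smul, one_smul, natCast_zsmul, add_sub_cancel_left]
  have hM1 : (0 : ℤ) < M - 1 := by
    have : M ≠ 1 := by
      rintro rfl
      exact hne i L (by simp [hend])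
    omega
  have hpos : 0 < dot v ((M - 1 : ℤ) • v) := by
    rw [dot_smul]
    exact mul_pos hM1 (dot_self_pos hv)
  have hneg : ¬ 0 < dot v ((-1 : ℤ) • v) := by
    rw [dot_smul]
    linarith [dot_self_pos hv]
  have hleft (k : ℕ) : 0 ≤ wedge v (chordDefect v w i k) := by
    rw [wedge_chordDefect]
    exact sub_nonneg.mpr (hi _)
  have hdot (k : ℕ) : 0 < dot (chordDefect v w i k) (chordDefect v w i (k + 1)) :=
    dot_pos_of_lattice_adj (lattice_adj_chordDefect_succ_right v hw i k) (hne _ _) (hne _ _)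
  rw [crossingSum_of_wedge_nonneg hv hleft hdot, hend, chordDefect_zero, ← neg_one_zsmul v,
    if_neg fun h => hneg h.2, if_pos ⟨wedge_smul_self v _, hpos⟩, zero_sub]

/-- Without a chord, the winding number of `chordDefect v w i` would not depend on `i`; but that
path runs from `-v` to a positive multiple of `v`, to the right of `v` where `w i` is leftmost and
to the left of `v` where `w i` is rightmost. -/
theorem exists_chord_of_add_smul_periodic {v : ℤ × ℤ} (hv : v ≠ 0) {w : ℕ → ℤ × ℤ}
    (hw : ∀ k, lattice.Adj (w k) (w (k + 1))) {L M : ℕ} (hM : M ≠ 0)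
    (hper : ∀ k, w (k + L) = w k + M • v) : ∃ i k, w (i + k) = w i + v := by
  by_contra! hno
  have hL : L ≠ 0 := by
    rintro rfl
    exact smul_ne_zero hM hv (left_eq_add.mp (hper 0))
  have hne (i k : ℕ) : chordDefect v w i k ≠ 0 := chordDefect_eq_zero_iff.not.mpr (hno i k)
  have hconst (i : ℕ) :
      crossingSum v (chordDefect v w i) L = crossingSum v (chordDefect v w 0) L := by
    induction i with
    | zero => rfl
    | succ i ih => rw [← crossingSum_chordDefect_succ hw hne hper hL, ih]
  have hperiodic : Function.Periodic (fun k => wedge v (w k)) L := fun k => by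
    simp only [hper, wedge, Prod.fst_add, Prod.snd_add, Prod.smul_fst, Prod.smul_snd]
    ring
  obtain ⟨t, ht⟩ := exists_forall_le_of_periodic hperiodic hL
  obtain ⟨b, hb⟩ := exists_forall_le_of_periodic (f := fun k => -wedge v (w k))
    (fun k => congrArg Neg.neg (hperiodic k)) hL
  have hright : crossingSum v (chordDefect v w t) L = 0 :=
    crossingSum_of_wedge_nonpos (fun k => by linarith [wedge_chordDefect v w t k, ht (t + k)]) L
  have hleft : crossingSum v (chordDefect v w b) L = -1 :=
    crossingSum_chordDefect_of_wedge_ge hv hw hne hM hper fun j => neg_le_neg_iff.mp (hb j)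
  rw [hconst] at hright hleft
  omega

end Lattice

section Graph

variable {V : Type*} {H : SimpleGraph V} {U U' S : Set V}

theorem exists_rank_forall_exists_adj_lt (H : SimpleGraph V) (S : Set V) :
    ∃ rank : V → ℕ, ∀ p ∉ S, ∀ h ∈ S, H.Reachable p h → ∃ q, H.Adj p q ∧ rank q < rank p := by
  let lengths (p : V) : Set ℕ := {n | ∃ h ∈ S, ∃ W : H.Walk p h, W.length = n}
  refine ⟨fun p => sInf (lengths p), fun p hp h hh ⟨W⟩ => ?_⟩
  obtain ⟨h', hh', W', hlength⟩ : ∃ h ∈ S, ∃ W : H.Walk p h, W.length = sInf (lengths p) :=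
    Nat.sInf_mem (s := lengths p) ⟨W.length, h, hh, W, rfl⟩
  cases W' with
  | nil => exact absurd hh' hp
  | cons hadj W'' =>
    refine ⟨_, hadj, ?_⟩
    beta_reduce
    rw [← hlength, SimpleGraph.Walk.length_cons, Nat.lt_succ_iff]
    exact Nat.sInf_le ⟨h', hh', W'', rfl⟩

/-- `S ∩ U` is a union of connected components of the subgraph of `H` induced on `U`. Points
of `S` outside of `U` are allowed, and do not matter. -/
def IsAdjClosedIn (H : SimpleGraph V) (U S : Set V) : Prop :=
  ∀ p ∈ U, p ∈ S → ∀ q ∈ U, H.Adj p q → q ∈ S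

theorem IsAdjClosedIn.mono (hS : IsAdjClosedIn H U S) (hU : U' ⊆ U) : IsAdjClosedIn H U' S :=
  fun p hp hpS q hq hpq => hS p (hU hp) hpS q (hU hq) hpq

theorem IsAdjClosedIn.subset_of_preconnected (hS : IsAdjClosedIn H U S)
    (hU : (H.induce U).Preconnected) (hne : (U ∩ S).Nonempty) : U ⊆ S := by
  obtain ⟨p, hp, hpS⟩ := hne
  intro q hq
  obtain ⟨W⟩ := hU ⟨p, hp⟩ ⟨q, hq⟩
  have transport (a b : U) (W : (H.induce U).Walk a b) (ha : (a : V) ∈ S) : (b : V) ∈ S := by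
    induction W with
    | nil => exact ha
    | @cons a c _ hac _ ih => exact ih (hS a a.2 ha c c.2 hac)
  exact transport _ _ W hpS

theorem isAdjClosedIn_image_supp (C : (H.induce U).ConnectedComponent) :
    IsAdjClosedIn H U (Subtype.val '' C.supp) := by
  rintro _ - ⟨p, hp, rfl⟩ q hq hpq
  have hadj : (H.induce U).Adj p ⟨q, hq⟩ := hpq
  exact ⟨⟨q, hq⟩, C.mem_supp_of_adj_mem_supp hp hadj, rfl⟩

end Graph

section Front

/-- The set `(A + v) \ A` of points that the translation of `A` by `v` adds to `A`. -/
def front (A : Set (ℤ × ℤ)) (v : ℤ × ℤ) : Set (ℤ × ℤ) := {p | p - v ∈ A ∧ p ∉ A}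

/-- The points of `front A v` beyond which, in the direction `v`, there are no points of `A`. Each
line parallel to `v` contains at most one of them. -/
def outerFront (A : Set (ℤ × ℤ)) (v : ℤ × ℤ) : Set (ℤ × ℤ) :=
  {p | p - v ∈ A ∧ ∀ k : ℕ, p + k • v ∉ A}

variable {A : Set (ℤ × ℤ)} {v p : ℤ × ℤ}

theorem outerFront_subset_front : outerFront A v ⊆ front A v :=
  fun _ hp => ⟨hp.1, by simpa using hp.2 0⟩

theorem exists_add_smul_mem_outerFront (hA : A.Finite) (hv : v ≠ 0) (hp : p - v ∈ A) :
    ∃ k : ℕ, p + k • v ∈ outerFront A v := by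
  have hinj : Function.Injective fun k : ℕ => p - v + k • v := fun a b h =>
    Nat.cast_injective (R := ℤ) (smul_left_injective ℤ hv (by simpa using h))
  obtain ⟨k, hk, hmax⟩ := Set.exists_max_image {k : ℕ | p - v + k • v ∈ A} id
    (hA.preimage hinj.injOn) ⟨0, by simpa using hp⟩
  refine ⟨k, by rw [add_sub_right_comm]; exact hk, fun m hm => ?_⟩
  have : k + (m + 1) ≤ k := hmax _ (by
    change p - v + (k + (m + 1)) • v ∈ A
    convert hm using 1
    module)
  lia

theorem add_succ_smul_notMem_outerFront (hp : p ∈ outerFront A v) (k : ℕ) :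
    p + (k + 1) • v ∉ outerFront A v := fun h =>
  hp.2 k (by simpa only [add_smul, one_smul, ← add_assoc, add_sub_cancel_right] using h.1)

theorem eq_zero_of_add_zsmul_mem_outerFront (hp : p ∈ outerFront A v) {n : ℤ}
    (hn : p + n • v ∈ outerFront A v) : n = 0 := by
  rcases lt_trichotomy n 0 with h | h | h
  · obtain ⟨k, hk⟩ := Int.eq_ofNat_of_zero_le (a := -n - 1) (by lia)
    refine absurd ?_ (add_succ_smul_notMem_outerFront hn k)
    rwa [← natCast_zsmul, Nat.cast_succ, ← hk, add_assoc, ← add_smul,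
      show n + (-n - 1 + 1) = 0 by ring, zero_smul, add_zero]
  · exact h
  · obtain ⟨k, hk⟩ := Int.eq_ofNat_of_zero_le (a := n - 1) (by lia)
    refine absurd ?_ (add_succ_smul_notMem_outerFront hp k)
    rwa [← natCast_zsmul, Nat.cast_succ, ← hk, sub_add_cancel]

theorem exists_step_outerFront (hA : A.Finite) (hv : v ≠ 0)
    (hcomp : ∀ C : (lattice.induce (front A v)).ConnectedComponent,
      ∃ p ∈ C.supp, (p : ℤ × ℤ) + v ∈ A) :
    ∃ rank : outerFront A v → ℕ, ∀ p : outerFront A v, ∃ q : outerFront A v, ∃ c : ℕ,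
      lattice.Adj (p : ℤ × ℤ) (q - c • v) ∧ c ≠ 1 ∧ (c = 0 → rank q < rank p) := by
  let toFront : outerFront A v → front A v := Set.inclusion outerFront_subset_front
  obtain ⟨rank, hrank⟩ := exists_rank_forall_exists_adj_lt (lattice.induce (front A v))
    {q | (q : ℤ × ℤ) ∉ outerFront A v}
  refine ⟨rank ∘ toFront, fun p => ?_⟩
  obtain ⟨h, hmem, hh⟩ := hcomp (SimpleGraph.connectedComponentMk _ (toFront p))
  obtain ⟨q, hadj, hlt⟩ := hrank (toFront p) (not_not.mpr p.2) h
    (fun hout => hout.2 1 (by simpa using hh)) (SimpleGraph.ConnectedComponent.exact hmem).symm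
  by_cases hq : (q : ℤ × ℤ) ∈ outerFront A v
  · exact ⟨⟨q, hq⟩, 0, by simpa using hadj, zero_ne_one, fun _ => hlt⟩
  -- Neither `q` nor, as `q ∉ A`, the point `q + v` belongs to `outerFront A v`.
  · obtain ⟨k, hk⟩ := exists_add_smul_mem_outerFront hA hv q.2.1
    refine ⟨⟨q + k • v, hk⟩, k, by simpa using hadj, ?_, ?_⟩
    · rintro rfl
      exact q.2.2 (by simpa using hk.1)
    · rintro rfl
      exact absurd (by simpa using hk) hq

/-- Undoing the shifts `c` accumulated along the orbit of `x` turns it into a lattice path. A chord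
`-v` of this path joins two points that, in the orbit, lie on the same line parallel to `v`. -/
theorem exists_birkhoffSum_eq_one {E : Set (ℤ × ℤ)} (hv : v ≠ 0)
    (hE : ∀ p ∈ E, ∀ n : ℤ, p + n • v ∈ E → n = 0) {f : E → E} {c : E → ℕ}
    (hadj : ∀ p : E, lattice.Adj (p : ℤ × ℤ) (f p - c p • v)) {x : E} {L : ℕ}
    (hx : Function.IsPeriodicPt f L x) (hL : birkhoffSum f c L x ≠ 0) :
    ∃ y k, birkhoffSum f c k y = 1 := by
  let w (t : ℕ) : ℤ × ℤ := f^[t] x - birkhoffSum f c t x • v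
  have hw (t : ℕ) : lattice.Adj (w t) (w (t + 1)) := by
    simp only [w]
    rw [birkhoffSum_succ, Function.iterate_succ_apply', add_smul, add_comm (_ • v), ← sub_sub]
    exact lattice_adj_sub_right.mpr (hadj (f^[t] x))
  have hper (t : ℕ) : w (t + L) = w t + birkhoffSum f c L x • (-v) := by
    simp only [w]
    rw [add_comm t, birkhoffSum_add, add_comm L, Function.iterate_add_apply, hx.eq, add_smul]
    module
  obtain ⟨i, k, hik⟩ := exists_chord_of_add_smul_periodic (neg_ne_zero.mpr hv) hw hL hper
  refine ⟨f^[i] x, k, ?_⟩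
  have hchord : (f^[k] (f^[i] x) : ℤ × ℤ) =
      f^[i] x + (((birkhoffSum f c k (f^[i] x) : ℕ) : ℤ) - 1) • v := by
    simp only [w] at hik
    rw [birkhoffSum_add, add_comm i, Function.iterate_add_apply, sub_eq_iff_eq_add] at hik
    rw [hik]
    module
  have := hE _ (f^[i] x).2 _ (hchord ▸ (f^[k] (f^[i] x)).2)
  lia

theorem exists_component_add_notMem (hA : A.Finite) (hne : A.Nonempty) (hv : v ≠ 0) :
    ∃ C : (lattice.induce (front A v)).ConnectedComponent,
      ∀ p ∈ C.supp, (p : ℤ × ℤ) + v ∉ A := by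
  by_contra! hcon
  obtain ⟨rank, hstep⟩ := exists_step_outerFront hA hv hcon
  choose f c hadj hone hrank using hstep
  have : Finite (outerFront A v) :=
    ((hA.preimage (sub_left_injective (b := v)).injOn).subset fun p hp => hp.1).to_subtype
  have : Nonempty (outerFront A v) := by
    obtain ⟨p, hp⟩ := hne
    obtain ⟨k, hk⟩ := exists_add_smul_mem_outerFront (p := p + v) hA hv (by simpa using hp)
    exact ⟨⟨_, hk⟩⟩
  obtain ⟨x, L, hL, hx⟩ := exists_isPeriodicPt_of_finite f
  obtain ⟨y, k, hyk⟩ := exists_birkhoffSum_eq_one hv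
    (fun p hp n => eq_zero_of_add_zsmul_mem_outerFront hp) hadj hx
    (birkhoffSum_ne_zero_of_isPeriodicPt hrank hL hx)
  exact birkhoffSum_ne_one hone k y hyk

end Front

namespace Assembly

variable {G : Type*} {T : Finset (Tile G)} {α β γ δ ε ν : Assembly T} {S : Set (ℤ × ℤ)}
  {v p q : ℤ × ℤ} {str : G → G → ℕ} {τ : ℕ}

theorem connected_induce_dom (α : Assembly T) : (lattice.induce α.dom).Connected := α.connected

theorem dom_nonempty (α : Assembly T) : α.dom.Nonempty :=
  Set.nonempty_coe_sort.mp α.connected_induce_dom.nonempty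

theorem mem_dom_translate : p ∈ (α.translate v).dom ↔ p - v ∈ α.dom := Iff.rfl

theorem tile_translate (α : Assembly T) (v p : ℤ × ℤ) :
    (α.translate v).tile p = α.tile (p - v) := rfl

theorem Nonoverlapping.symm (h : α.Nonoverlapping β) : β.Nonoverlapping α := by
  rwa [Nonoverlapping, Set.inter_comm]

theorem Nonoverlapping.notMem (h : α.Nonoverlapping β) (hp : p ∈ α.dom) : p ∉ β.dom :=
  fun hp' => Set.eq_empty_iff_forall_notMem.mp h p ⟨hp, hp'⟩

theorem Nonoverlapping.translate (h : α.Nonoverlapping β) (v : ℤ × ℤ) :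
    (α.translate v).Nonoverlapping (β.translate v) :=
  Set.eq_empty_iff_forall_notMem.mpr fun p => Set.eq_empty_iff_forall_notMem.mp h (p - v)

theorem Singular.translate (h : α.Singular) (v : ℤ × ℤ) : (α.translate v).Singular := by
  obtain ⟨a, ha⟩ := Set.ncard_eq_one.mp h
  refine Set.ncard_eq_one.mpr ⟨a + v, ?_⟩
  ext p
  rw [mem_dom_translate, ha, Set.mem_singleton_iff, Set.mem_singleton_iff, sub_eq_iff_eq_add]

theorem Singular.dom_subset_of_inter_nonempty (h : ν.Singular) (hov : (γ.dom ∩ ν.dom).Nonempty) :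
    ν.dom ⊆ γ.dom := by
  obtain ⟨a, ha⟩ := Set.ncard_eq_one.mp h
  rw [ha] at hov ⊢
  exact Set.singleton_subset_iff.mpr (Set.inter_singleton_nonempty.mp hov)

theorem IsUnion.symm (h : γ.IsUnion α β) : γ.IsUnion β α :=
  ⟨by rw [h.1, Set.union_comm], h.2.2, h.2.1⟩

theorem IsUnion.dom_subset_left (h : γ.IsUnion α β) : α.dom ⊆ γ.dom :=
  h.1 ▸ Set.subset_union_left

theorem IsUnion.translate (h : γ.IsUnion α β) (v : ℤ × ℤ) :
    (γ.translate v).IsUnion (α.translate v) (β.translate v) :=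
  ⟨by ext p; simp only [mem_dom_translate, Set.mem_union, h.1],
    fun p hp => h.2.1 (p - v) hp, fun p hp => h.2.2 (p - v) hp⟩

theorem Consistent.of_isUnion_left (hc : γ.Consistent ν) (hν : ν.IsUnion α β) :
    γ.Consistent α := fun p hp =>
  (hc p ⟨hp.1, hν.dom_subset_left hp.2⟩).trans (hν.2.1 p hp.2)

theorem exists_isUnion (hc : α.Consistent β) (h : (lattice.induce (α.dom ∪ β.dom)).Connected) :
    ∃ γ : Assembly T, γ.IsUnion α β := by
  have hdom : {p | ((α.tile p).or (β.tile p)).isSome} = α.dom ∪ β.dom := by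
    ext p
    simp [dom, Option.isSome_or]
  refine ⟨⟨fun p => (α.tile p).or (β.tile p), by rwa [hdom]⟩, hdom,
    fun p hp => Option.or_of_isSome hp, fun p hp => ?_⟩
  by_cases hpα : p ∈ α.dom
  · rw [← hc p ⟨hpα, hp⟩]
    exact Option.or_of_isSome hpα
  · simp [Option.not_isSome_iff_eq_none.mp hpα]

theorem IsUnion.exists_adj (h : γ.IsUnion α β) (hd : α.Nonoverlapping β) :
    ∃ p ∈ α.dom, ∃ q ∈ β.dom, lattice.Adj p q := by
  by_contra! hno
  have hclosed : IsAdjClosedIn lattice γ.dom α.dom := fun p _ hp q hq hpq =>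
    (h.1 ▸ hq : q ∈ α.dom ∪ β.dom).resolve_right fun hq => hno p hp q hq hpq
  obtain ⟨p, hp⟩ := α.dom_nonempty
  obtain ⟨q, hq⟩ := β.dom_nonempty
  have hsub : γ.dom ⊆ α.dom := hclosed.subset_of_preconnected
    γ.connected_induce_dom.preconnected ⟨p, h.dom_subset_left hp, hp⟩
  exact hd.notMem (hsub (h.symm.dom_subset_left hq)) hq

theorem edgeWeight_congr (str : G → G → ℕ) (hp : α.tile p = β.tile p)
    (hq : α.tile q = β.tile q) : α.edgeWeight str p q = β.edgeWeight str p q := by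
  rw [edgeWeight, edgeWeight, hp, hq]

theorem edgeWeight_comm (str : G → G → ℕ) (α : Assembly T) (p q : ℤ × ℤ) :
    α.edgeWeight str p q = α.edgeWeight str q p := by
  unfold edgeWeight
  obtain ⟨p₁, p₂⟩ := p
  obtain ⟨q₁, q₂⟩ := q
  cases α.tile (p₁, p₂) <;> cases α.tile (q₁, q₂) <;> simp only
  simp only [Prod.mk_add_mk, Prod.mk.injEq]
  split_ifs <;> first | rfl | omega

theorem edgeWeight_translate (str : G → G → ℕ) (α : Assembly T) (v p q : ℤ × ℤ) :
    (α.translate v).edgeWeight str (p + v) (q + v) = α.edgeWeight str p q := by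
  simp only [edgeWeight, tile_translate, add_sub_cancel_right, add_right_comm _ v, add_left_inj]

theorem StableEdges.map {C C' : Set ((ℤ × ℤ) × (ℤ × ℤ))} (h : α.StableEdges str τ C)
    (e : (ℤ × ℤ) × (ℤ × ℤ) ↪ (ℤ × ℤ) × (ℤ × ℤ)) (hC : ∀ x ∈ C, e x ∈ C')
    (hw : ∀ x ∈ C, β.edgeWeight str (e x).1 (e x).2 = α.edgeWeight str x.1 x.2) :
    β.StableEdges str τ C' := by
  obtain ⟨F, hF, hτ⟩ := h
  refine ⟨F.map e, ?_, ?_⟩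
  · rw [Finset.coe_map, Set.image_subset_iff]
    exact fun x hx => hC x (hF hx)
  · rwa [Finset.sum_map, Finset.sum_congr rfl fun x hx => hw x (hF hx)]

theorem StableEdges.symm (h : γ.StableEdges str τ (α.cut β)) :
    γ.StableEdges str τ (β.cut α) :=
  h.map (Equiv.prodComm _ _).toEmbedding (fun _ hx => ⟨hx.2.1, hx.1, hx.2.2.symm⟩)
    fun _ _ => edgeWeight_comm str γ _ _

theorem StableEdges.translate (h : γ.StableEdges str τ (α.cut β)) (v : ℤ × ℤ) :
    (γ.translate v).StableEdges str τ ((α.translate v).cut (β.translate v)) := by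
  refine h.map ((Equiv.addRight v).prodCongr (Equiv.addRight v)).toEmbedding (fun x hx => ?_)
    fun x _ => edgeWeight_translate str γ v _ _
  refine ⟨?_, ?_, lattice_adj_add_right.mpr hx.2.2⟩
  · simpa [mem_dom_translate] using hx.1
  · simpa [mem_dom_translate] using hx.2.1

/-- `δ` is the union of `γ` and of the restriction of `ν` to the set `S`. That restriction need not
be an assembly, as its domain need not be connected. -/
def IsPartialUnion (δ γ ν : Assembly T) (S : Set (ℤ × ℤ)) : Prop :=
  δ.dom = γ.dom ∪ (ν.dom ∩ S) ∧ (∀ p ∈ γ.dom, δ.tile p = γ.tile p) ∧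
    ∀ p ∈ ν.dom ∩ S, δ.tile p = ν.tile p

theorem Consistent.isPartialUnion_self (hc : γ.Consistent ν) (h : ν.dom ∩ S ⊆ γ.dom) :
    γ.IsPartialUnion γ ν S :=
  ⟨(Set.union_eq_left.mpr h).symm, fun _ _ => rfl, fun p hp => hc p ⟨h hp, hp.1⟩⟩

theorem IsUnion.isPartialUnion (h : δ.IsUnion γ ν) (hS : ν.dom ⊆ S) :
    δ.IsPartialUnion γ ν S := by
  rw [IsPartialUnion, Set.inter_eq_left.mpr hS]
  exact h

theorem IsPartialUnion.dom_subset (h : δ.IsPartialUnion γ ν S) : γ.dom ⊆ δ.dom :=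
  h.1 ▸ Set.subset_union_left

theorem IsPartialUnion.dom_inter_subset (h : δ.IsPartialUnion γ ν S) : ν.dom ∩ S ⊆ δ.dom :=
  h.1 ▸ Set.subset_union_right

theorem IsPartialUnion.consistent (h : δ.IsPartialUnion γ α S) (hν : ν.IsUnion α β)
    (hc : γ.Consistent ν) : δ.Consistent ν := by
  rintro p ⟨hp, hpν⟩
  rw [h.1] at hp
  rcases hp with hp | hp
  · rw [h.2.1 p hp, hc p ⟨hp, hpν⟩]
  · rw [h.2.2 p hp, hν.2.1 p hp.1]

theorem IsPartialUnion.trans (h : δ.IsPartialUnion γ α S) (h' : ε.IsPartialUnion δ β S)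
    (hν : ν.IsUnion α β) : ε.IsPartialUnion γ ν S := by
  refine ⟨?_, fun p hp => by rw [h'.2.1 p (h.dom_subset hp), h.2.1 p hp], ?_⟩
  · rw [h'.1, h.1, hν.1, Set.union_inter_distrib_right, Set.union_assoc]
  · rintro p ⟨hp, hpS⟩
    rw [hν.1] at hp
    rcases hp with hp | hp
    · rw [h'.2.1 p (h.dom_inter_subset ⟨hp, hpS⟩), h.2.2 p ⟨hp, hpS⟩, hν.2.1 p hp]
    · rw [h'.2.2 p ⟨hp, hpS⟩, hν.2.2 p hp]

theorem IsPartialUnion.mem_dom_of_adj (h : δ.IsPartialUnion γ α S) (hν : ν.IsUnion α β)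
    (hS : IsAdjClosedIn lattice (ν.dom \ γ.dom) S) (hδβ : δ.Nonoverlapping β) (hβS : β.dom ⊆ S)
    (hp : p ∈ α.dom) (hq : q ∈ β.dom) (hpq : lattice.Adj p q) : p ∈ δ.dom := by
  by_cases hpγ : p ∈ γ.dom
  · exact h.dom_subset hpγ
  · have hqγ : q ∉ γ.dom := fun hqγ => hδβ.notMem (h.dom_subset hqγ) hq
    have hqν : q ∈ ν.dom \ γ.dom := ⟨hν.symm.dom_subset_left hq, hqγ⟩
    have hpν : p ∈ ν.dom \ γ.dom := ⟨hν.dom_subset_left hp, hpγ⟩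
    exact h.dom_inter_subset ⟨hp, hS q hqν (hβS hq) p hpν hpq.symm⟩

theorem IsPartialUnion.consistent_translate
    (hγ : γ.IsPartialUnion α (α.translate v) S) (hc : α.Consistent (α.translate v))
    (hS : ∀ p ∈ S, p ∉ α.dom) (hSv : ∀ p ∈ S, p + v ∉ α.dom) :
    γ.Consistent (γ.translate v) := by
  rintro p ⟨hp, hp'⟩
  rw [mem_dom_translate, hγ.1] at hp'
  have hpv : p - v ∈ α.dom := by
    refine hp'.resolve_right fun hpS => hS _ hpS.2 ?_
    have hpα : p ∉ α.dom := by simpa using hSv _ hpS.2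
    exact ((hγ.1 ▸ hp).resolve_left hpα).1
  rw [tile_translate, hγ.2.1 _ hpv]
  rw [hγ.1] at hp
  rcases hp with hp | hp
  · rw [hγ.2.1 p hp, hc p ⟨hp, hpv⟩, tile_translate]
  · rw [hγ.2.2 p hp, tile_translate]

end Assembly

section Producible

open Assembly

variable {G : Type*} {𝒯 : HierarchicalTAS G} {α β γ δ ν : Assembly 𝒯.tiles} {S : Set (ℤ × ℤ)}

namespace HierarchicalTAS

theorem Producible.finite_dom (h : 𝒯.Producible α) : α.dom.Finite := by
  induction h with
  | singular γ h => exact Set.finite_of_ncard_ne_zero (h ▸ one_ne_zero)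
  | union α β γ _ _ _ hγ _ ihα ihβ => exact hγ.1 ▸ ihα.union ihβ

theorem Producible.translate (h : 𝒯.Producible α) (v : ℤ × ℤ) :
    𝒯.Producible (α.translate v) := by
  induction h with
  | singular γ h => exact .singular _ (h.translate v)
  | union α β γ _ _ hd hγ hs ihα ihβ =>
    exact .union _ _ _ ihα ihβ (hd.translate v) (hγ.translate v) (hs.translate v)

theorem Producible.exists_isUnion_of_stableEdges (hδ : 𝒯.Producible δ) (hβ : 𝒯.Producible β)
    (hαβ : α.Nonoverlapping β) (hν : ν.IsUnion α β)
    (hs : ν.StableEdges 𝒯.str 𝒯.temperature (α.cut β)) (hδβ : δ.Nonoverlapping β)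
    (hc : δ.Consistent ν) (hcut : ∀ p ∈ α.dom, ∀ q ∈ β.dom, lattice.Adj p q → p ∈ δ.dom) :
    ∃ ε, 𝒯.Producible ε ∧ ε.IsUnion δ β := by
  obtain ⟨a, ha, b, hb, hab⟩ := hν.exists_adj hαβ
  obtain ⟨ε, hε⟩ := exists_isUnion (hc.of_isUnion_left hν.symm)
    (SimpleGraph.connected_induce_union δ.connected_induce_dom.preconnected
      β.connected_induce_dom.preconnected (hcut a ha b hb hab) hb hab)
  refine ⟨ε, .union δ β ε hδ hβ hδβ hε (hs.map (.refl _) ?_ ?_), hε⟩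
  · exact fun x hx => ⟨hcut _ hx.1 _ hx.2.1 hx.2.2, hx.2⟩
  · rintro x ⟨hx, hx', hadj⟩
    have hxδ := hcut _ hx _ hx' hadj
    exact edgeWeight_congr _
      ((hε.2.1 _ hxδ).trans (hc _ ⟨hxδ, hν.dom_subset_left hx⟩))
      ((hε.2.2 _ hx').trans (hν.2.2 _ hx').symm)

/-- Replay the production of `ν` on top of `γ`, beginning with the parts of `ν` that `γ` overlaps.
Since `S` is a union of components, a part that does not overlap the assembly built so far is either
skipped altogether, or attached along the same edges as in the production of `ν`. -/
theorem Producible.exists_isPartialUnion (hν : 𝒯.Producible ν) (hγ : 𝒯.Producible γ)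
    (hov : (γ.dom ∩ ν.dom).Nonempty) (hc : γ.Consistent ν)
    (hS : IsAdjClosedIn lattice (ν.dom \ γ.dom) S) :
    ∃ δ, 𝒯.Producible δ ∧ δ.IsPartialUnion γ ν S := by
  induction hν generalizing γ with
  | singular ν h =>
    exact ⟨γ, hγ, hc.isPartialUnion_self
      (Set.inter_subset_left.trans (h.dom_subset_of_inter_nonempty hov))⟩
  | union α β ν hα hβ hd hν hs ihα ihβ =>
    wlog hαγ : (γ.dom ∩ α.dom).Nonempty generalizing α β
    · refine this β α hβ hα hd.symm hν.symm hs.symm ihβ ihα ?_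
      rw [hν.1, Set.inter_union_distrib_left, Set.union_nonempty] at hov
      exact hov.resolve_left hαγ
    obtain ⟨δ, hδ, hδγ⟩ := ihα hγ hαγ (hc.of_isUnion_left hν)
      (hS.mono (Set.sdiff_subset_sdiff_left hν.dom_subset_left))
    have hδν : δ.Consistent ν := hδγ.consistent hν hc
    have hδβ : δ.Consistent β := hδν.of_isUnion_left hν.symm
    have hSβ : IsAdjClosedIn lattice (β.dom \ δ.dom) S :=
      hS.mono (Set.sdiff_subset_sdiff hν.symm.dom_subset_left hδγ.dom_subset)
    suffices ∃ ε, 𝒯.Producible ε ∧ ε.IsPartialUnion δ β S by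
      obtain ⟨ε, hε, hεδ⟩ := this
      exact ⟨ε, hε, hδγ.trans hεδ hν⟩
    rcases (δ.dom ∩ β.dom).eq_empty_or_nonempty with hdisj | hδov
    · rcases (β.dom ∩ S).eq_empty_or_nonempty with hβS | hβS
      · exact ⟨δ, hδ, hδβ.isPartialUnion_self (hβS ▸ Set.empty_subset _)⟩
      · have hβδ : β.dom \ δ.dom = β.dom :=
          sdiff_eq_left.mpr (Set.disjoint_iff_inter_eq_empty.mpr hdisj).symm
        have hsub : β.dom ⊆ S :=
          (hβδ ▸ hSβ).subset_of_preconnected β.connected_induce_dom.preconnected hβS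
        obtain ⟨ε, hε, hεδ⟩ := hδ.exists_isUnion_of_stableEdges hβ hd hν hs hdisj hδν
          fun p hp q hq hpq => hδγ.mem_dom_of_adj hν hS hdisj hsub hp hq hpq
        exact ⟨ε, hε, hεδ.isPartialUnion hsub⟩
    · exact ihβ hδ hδov hδβ hSβ

theorem Producible.exists_larger_repetitious (hα : 𝒯.Producible α)
    (hrep : α.Repetitious) :
    ∃ γ, 𝒯.Producible γ ∧ γ.Repetitious ∧ α.dom.ncard < γ.dom.ncard := by
  obtain ⟨v, hv, hov, hc⟩ := hrep
  obtain ⟨C, hC⟩ := exists_component_add_notMem hα.finite_dom α.dom_nonempty hv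
  obtain ⟨γ, hγ, hγα⟩ := (hα.translate v).exists_isPartialUnion hα hov hc
    (isAdjClosedIn_image_supp C)
  refine ⟨γ, hγ, ⟨v, hv, ?_, hγα.consistent_translate hc ?_ ?_⟩, ?_⟩
  · exact hov.mono (Set.inter_subset_inter hγα.dom_subset fun p hp => hγα.dom_subset hp)
  · rintro _ ⟨p, -, rfl⟩
    exact p.2.2
  · rintro _ ⟨p, hp, rfl⟩
    exact hC p hp
  · obtain ⟨p, hp⟩ := C.nonempty_supp
    exact Set.ncard_lt_ncard ((Set.ssubset_iff_of_subset hγα.dom_subset).mpr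
      ⟨p, hγα.dom_inter_subset ⟨p.2.1, p, hp, rfl⟩, p.2.2⟩) hγ.finite_dom

end HierarchicalTAS

end Producible

end TileAssembly

theorem theorem3 {G : Type*} (𝒯 : TileAssembly.HierarchicalTAS G)
    (h : ∃ α : TileAssembly.Assembly 𝒯.tiles, 𝒯.Producible α ∧ α.Repetitious) :
    ∀ n : ℕ, ∃ γ : TileAssembly.Assembly 𝒯.tiles, 𝒯.Producible γ ∧ n < γ.dom.ncard := by
  suffices grow : ∀ n : ℕ, ∃ γ : TileAssembly.Assembly 𝒯.tiles,
      𝒯.Producible γ ∧ γ.Repetitious ∧ n < γ.dom.ncard from fun n =>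
    (grow n).imp fun _ hγ => ⟨hγ.1, hγ.2.2⟩
  intro n
  induction n with
  | zero =>
    obtain ⟨α, hα, hrep⟩ := h
    exact ⟨α, hα, hrep, (Set.ncard_pos hα.finite_dom).mpr α.dom_nonempty⟩
  | succ n ih =>
    obtain ⟨α, hα, hrep, hn⟩ := ih
    obtain ⟨γ, hγ, hγrep, hlt⟩ := hα.exists_larger_repetitious hrep
    exact ⟨γ, hγ, hγrep, lt_of_le_of_lt hn hlt⟩
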